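/- A function $\Phi:[0,\infty]\to[0,\infty]$ is called a Young function if it is convex and left-continuous, with $\lim_{r\to+0}\Phi(r)=\Phi(0)=0$ and $\lim_{r\to\infty}\Phi(r)=\Phi(\infty)=\infty$. For a Young function $\Phi$ put $\Phi^{-1}(s)=\inf\{r\ge 0:\Phi(r)>s\}$ (with $\inf\emptyset=\infty$), and write $\Phi\in\nabla_2$ if there is $C>1$ with $\Phi(r)\le\frac{1}{2C}\Phi(Cr)$ for all $r\ge 0$. Let $$L^\Phi(\mathbb R^n)=\Big\{f\in L^1_{\rm loc}(\mathbb R^n):\int_{\mathbb R^n}\Phi(k|f(x)|)\,dx<\infty\text{ for some }k>0\Big\},\qquad \|f\|_{L^\Phi}=\inf\Big\{\lambda>0:\int_{\mathbb R^n}\Phi\Big(\frac{|f(x)|}{\lambda}\Big)dx\le 1\Big\},$$ and let ${\rm W}L^\Phi(\mathbb R^n)$ be the set of measurable $f$ with $\|f\|_{{\rm W}L^\Phi}=\sup_{\lambda>0}\|\lambda\,\chi_{\{|f|>\lambda\}}\|_{L^\Phi}<\infty$. For $\rho:(0,\infty)\to(0,\infty)$ let $$M_\rho f(x)=\sup_{r>0}\frac{\rho(r)}{|B(x,r)|}\int_{B(x,r)}|f(y)|\,dy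 .$$ Saying that $M_\rho$ is bounded from $X$ to $Y$ means that $M_\rho f\in Y$ for all $f\in X$ and that $\|M_\rho f\|_Y\le C\|f\|_X$ with a constant $C>0$ independent of $f\in X$. **Theorem.** Let $n\ge 1$, let $\Phi,\Psi$ be Young functions, and let $\rho:(0,\infty)\to(0,\infty)$ be (not necessarily strictly) increasing and such that $r\mapsto r^{-n}\rho(r)$ is (not necessarily strictly) decreasing on $(0,\infty)$. Consider the condition that there is a constant $C>0$ such that $$\rho(r)\le C\,\frac{\Psi^{-1}(r^{-n})}{\Phi^{-1}(r^{-n})}\qquad\text{for all } r>0. \tag{$*$}$$ 1. Condition $(*)$ is necessary and sufficient for the boundedness of $M_\rho$ from $L^\Phi(\mathbb R^n)$ to ${\rm W}L^\Psi(\mathbb R^n)$. 2. If $\Phi\in\nabla_2$, then condition $(*)$ is necessary and sufficient for the boundedness of $M_\rho$ from $L^\Phi(\mathbb R^n)$ to $L^\Psi(\mathbb R^n)$. -/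

import Mathlib

open MeasureTheory Set Filter Topology
open scoped ENNReal NNReal

/-- A Young function `Φ : [0,∞] → [0,∞]`: convex, left-continuous, with
`lim_{r → 0+} Φ r = Φ 0 = 0` and `lim_{r → ∞} Φ r = Φ ∞ = ∞`. -/
structure IsYoungFunction (Φ : ℝ≥0∞ → ℝ≥0∞) : Prop where
  convexOn : ConvexOn ℝ≥0 univ Φ
  left_continuous : ∀ r : ℝ≥0∞, ContinuousWithinAt Φ (Iio r) r
  map_zero : Φ 0 = 0
  tendsto_zero : Tendsto Φ (𝓝[>] 0) (𝓝 0)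
  map_top : Φ ∞ = ∞
  tendsto_top : Tendsto Φ (𝓝[<] ∞) (𝓝 ∞)

/-- The generalized inverse `Φ⁻¹(s) = inf {r ≥ 0 : Φ r > s}`, with `inf ∅ = ∞`. -/
noncomputable def youngInv (Φ : ℝ≥0∞ → ℝ≥0∞) (s : ℝ≥0∞) : ℝ≥0∞ :=
  sInf {r : ℝ≥0∞ | s < Φ r}

/-- The `∇₂`-condition: for some `C > 1`, `Φ r ≤ (1 / (2C)) Φ (C r)` for all `0 ≤ r < ∞`. -/
def Nabla2 (Φ : ℝ≥0∞ → ℝ≥0∞) : Prop :=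
  ∃ C : ℝ≥0, 1 < C ∧ ∀ r : ℝ≥0, Φ r ≤ Φ (C * r) / (2 * C)

/- The spaces below are defined both for scalar-valued functions and for `[0,∞]`-valued functions
such as maximal functions; `‖f x‖ₑ` is `|f x|` as an element of `[0,∞]`. -/

section Spaces

variable {n : ℕ} {ε : Type*}

/-- The Luxemburg–Nakano norm
`‖f‖_{L^Φ} = inf {t > 0 : ∫ Φ (|f x| / t) dx ≤ 1}` on `ℝⁿ`, with `inf ∅ = ∞`. -/
noncomputable def orliczNorm [ENorm ε] (Φ : ℝ≥0∞ → ℝ≥0∞) (f : EuclideanSpace ℝ (Fin n) → ε) :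
    ℝ≥0∞ :=
  ⨅ (t : ℝ≥0) (_ : 0 < t) (_ : ∫⁻ x, Φ (‖f x‖ₑ / t) ≤ 1), (t : ℝ≥0∞)

/-- Membership in the Orlicz space `L^Φ(ℝⁿ)`: `f ∈ L¹_loc` and `∫ Φ (k |f x|) dx < ∞` for some
`k > 0`. -/
def MemOrlicz [TopologicalSpace ε] [ContinuousENorm ε] (Φ : ℝ≥0∞ → ℝ≥0∞)
    (f : EuclideanSpace ℝ (Fin n) → ε) : Prop :=
  LocallyIntegrable f volume ∧ ∃ k : ℝ≥0, 0 < k ∧ ∫⁻ x, Φ (k * ‖f x‖ₑ) < ∞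

/-- The weak Orlicz quasi-norm `‖f‖_{WL^Φ} = sup_{t > 0} ‖t χ_{|f| > t}‖_{L^Φ}`. -/
noncomputable def weakOrliczNorm [ENorm ε] (Φ : ℝ≥0∞ → ℝ≥0∞)
    (f : EuclideanSpace ℝ (Fin n) → ε) : ℝ≥0∞ :=
  ⨆ (t : ℝ≥0) (_ : 0 < t),
    orliczNorm Φ ({x | (t : ℝ≥0∞) < ‖f x‖ₑ}.indicator fun _ => (t : ℝ≥0∞))

/-- Membership in the weak Orlicz space `WL^Φ(ℝⁿ)`: measurable, with finite quasi-norm. -/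
def MemWeakOrlicz [TopologicalSpace ε] [ContinuousENorm ε] (Φ : ℝ≥0∞ → ℝ≥0∞)
    (f : EuclideanSpace ℝ (Fin n) → ε) : Prop :=
  AEStronglyMeasurable f volume ∧ weakOrliczNorm Φ f < ∞

/-- The generalized fractional maximal operator
`M_ρ f x = sup_{r > 0} (ρ r / |B(x,r)|) ∫_{B(x,r)} |f y| dy`, as a `[0,∞]`-valued function. -/
noncomputable def fracMaximal [ENorm ε] (ρ : ℝ → ℝ) (f : EuclideanSpace ℝ (Fin n) → ε)
    (x : EuclideanSpace ℝ (Fin n)) : ℝ≥0∞ :=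
  ⨆ (r : ℝ) (_ : 0 < r),
    ENNReal.ofReal (ρ r) / volume (Metric.ball x r) * ∫⁻ y in Metric.ball x r, ‖f y‖ₑ

end Spaces

/-- `M_ρ` is bounded from `L^Φ(ℝⁿ)` to `L^Ψ(ℝⁿ)` (functions with values in `𝕜`). -/
def FracMaximalBounded (𝕜 : Type*) [RCLike 𝕜] (n : ℕ) (ρ : ℝ → ℝ) (Φ Ψ : ℝ≥0∞ → ℝ≥0∞) : Prop :=
  ∃ C : ℝ≥0, 0 < C ∧ ∀ f : EuclideanSpace ℝ (Fin n) → 𝕜, MemOrlicz Φ f →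
    MemOrlicz Ψ (fracMaximal ρ f) ∧ orliczNorm Ψ (fracMaximal ρ f) ≤ C * orliczNorm Φ f

/-- `M_ρ` is bounded from `L^Φ(ℝⁿ)` to `WL^Ψ(ℝⁿ)` (functions with values in `𝕜`). -/
def FracMaximalWeakBounded (𝕜 : Type*) [RCLike 𝕜] (n : ℕ) (ρ : ℝ → ℝ) (Φ Ψ : ℝ≥0∞ → ℝ≥0∞) :
    Prop :=
  ∃ C : ℝ≥0, 0 < C ∧ ∀ f : EuclideanSpace ℝ (Fin n) → 𝕜, MemOrlicz Φ f →
    MemWeakOrlicz Ψ (fracMaximal ρ f) ∧ weakOrliczNorm Ψ (fracMaximal ρ f) ≤ C * orliczNorm Φ f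

/-- There is `C > 0` with `ρ r ≤ C Ψ⁻¹(r⁻ⁿ) / Φ⁻¹(r⁻ⁿ)` for all `r > 0`. -/
def RhoCondition (n : ℕ) (ρ : ℝ → ℝ) (Φ Ψ : ℝ≥0∞ → ℝ≥0∞) : Prop :=
  ∃ C : ℝ≥0, 0 < C ∧ ∀ r : ℝ, 0 < r →
    ENNReal.ofReal (ρ r) ≤
      C * (youngInv Ψ (ENNReal.ofReal (r ^ (-(n : ℤ)))) /
        youngInv Φ (ENNReal.ofReal (r ^ (-(n : ℤ)))))

/-!
`M` denotes the Hardy–Littlewood maximal operator, which is `fracMaximal` for the constant function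
`ρ = 1`, and `f` is normalized by `∫ Φ(|f|) ≤ 1`.

*Sufficiency.* Let `a` be the average of `|f|` over `B(x, r)`. Jensen's inequality
(`IsYoungFunction.map_laverage_le`) gives `Φ(a) ≤ M(Φ(|f|))(x)` and also `Φ(a) ≤ 1 / |B(x, r)|`, so
that, after multiplication of `a` by a constant, `u = Φ(a)` is `r'⁻ⁿ` for some `r' ≥ r` (when it is
`0`, arbitrarily small `u > 0` are used instead). As `ρ` increases, the condition at `r'` yields
`ρ(r) a ≤ ρ(r') Φ⁻¹(u) ≤ C Ψ⁻¹(u)`, and hence `Ψ(ρ(r) a / C) ≤ Φ(a)` (`map_mul_div_le_map`). Taking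
the supremum over `r`, for some `κ > 0`, `Ψ(κ M_ρ f) ≤ M(Φ(|f|))` and `Ψ(κ M_ρ f) ≤ Φ(M f)`
(`exists_map_fracMaximal_le`). The weak bound follows from the first estimate and the weak type
`(1,1)` inequality for `M` (`mul_volume_lt_fracMaximal_one_le`). The strong bound follows from the
second one and the modular inequality `∫ Φ(M f / K) ≤ 1` for `Φ ∈ ∇₂`
(`exists_lintegral_map_fracMaximal_one_le`). The latter is obtained by cutting `M f` at the levels
`C ^ k`, `k ∈ ℤ`, where `C` is the constant of `∇₂`, and applying the weak type inequality to the
part of `f` above half of each level; `∇₂` makes the resulting sum over `k` geometric.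

*Necessity.* A strong bound implies a weak one. For the weak bound the test function is the
indicator of a ball `B` of volume `rⁿ`: its norm is at most `1 / Φ⁻¹(r⁻ⁿ)`, its maximal function is
at least `2⁻ⁿ ρ(R)` on `B`, `R` being the radius of `B`, and `ρ(R)` is comparable to `ρ(r)` by the
two monotonicity hypotheses.
-/

/-! ### Young functions -/

namespace IsYoungFunction

variable {Φ : ℝ≥0∞ → ℝ≥0∞}

theorem map_mul_le (hΦ : IsYoungFunction Φ) {θ : ℝ≥0} (hθ : θ ≤ 1) (r : ℝ≥0∞) :
    Φ (θ * r) ≤ θ * Φ r := by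
  have h := hΦ.convexOn.2 (mem_univ r) (mem_univ 0) (zero_le (a := θ)) (zero_le (a := 1 - θ))
    (add_tsub_cancel_of_le hθ)
  simpa [ENNReal.smul_def, hΦ.map_zero] using h

theorem monotone (hΦ : IsYoungFunction Φ) : Monotone Φ := by
  intro a b hab
  rcases eq_or_ne b ∞ with rfl | hb
  · simp [hΦ.map_top]
  rcases eq_or_ne b 0 with rfl | hb0
  · rw [nonpos_iff_eq_zero.1 hab]
  lift b to ℝ≥0 using hb
  lift a to ℝ≥0 using ne_top_of_le_ne_top ENNReal.coe_ne_top hab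
  have hb0' : b ≠ 0 := by simpa using hb0
  have hab' : a ≤ b := by exact_mod_cast hab
  have hθ : a / b ≤ 1 := div_le_one_of_le₀ hab' (zero_le)
  have h := hΦ.map_mul_le hθ b
  rw [← ENNReal.coe_mul, div_mul_cancel₀ _ hb0'] at h
  refine h.trans ?_
  calc ((a / b : ℝ≥0) : ℝ≥0∞) * Φ b ≤ 1 * Φ b := by gcongr; exact_mod_cast hθ
    _ = Φ b := one_mul _

/-- Left-continuity of a Young function, in the form of lower semicontinuity. -/
theorem exists_lt_of_lt_map (hΦ : IsYoungFunction Φ) {a b : ℝ≥0∞} (h : b < Φ a) :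
    ∃ a' < a, b < Φ a' := by
  have ha : a ≠ 0 := by
    rintro rfl
    simp [hΦ.map_zero] at h
  have : NeBot (𝓝[<] a) := nhdsLT_neBot_of_exists_lt ⟨0, pos_iff_ne_zero.2 ha⟩
  have h1 : ∀ᶠ x in 𝓝[<] a, b < Φ x := (hΦ.left_continuous a).eventually (lt_mem_nhds h)
  obtain ⟨x, hx, hx'⟩ := (h1.and self_mem_nhdsWithin).exists
  exact ⟨x, hx', hx⟩

theorem map_iSup_le (hΦ : IsYoungFunction Φ) {ι : Sort*} {u : ι → ℝ≥0∞} {c : ℝ≥0∞}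
    (h : ∀ i, Φ (u i) ≤ c) : Φ (⨆ i, u i) ≤ c := by
  by_contra! hc
  obtain ⟨a, ha, hca⟩ := hΦ.exists_lt_of_lt_map hc
  obtain ⟨i, hi⟩ := lt_iSup_iff.1 ha
  exact absurd (h i) (not_le.2 (hca.trans_le (hΦ.monotone hi.le)))

theorem le_youngInv (hΦ : IsYoungFunction Φ) {r s : ℝ≥0∞} (h : Φ r ≤ s) : r ≤ youngInv Φ s := by
  refine le_sInf fun x hx => ?_
  by_contra! hxr
  exact absurd (hΦ.monotone hxr.le) (not_le.2 (h.trans_lt hx))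

theorem map_youngInv_le (hΦ : IsYoungFunction Φ) (s : ℝ≥0∞) : Φ (youngInv Φ s) ≤ s := by
  by_contra! h
  obtain ⟨a, ha, hs⟩ := hΦ.exists_lt_of_lt_map h
  exact absurd (sInf_le (show a ∈ {r : ℝ≥0∞ | s < Φ r} from hs)) (not_le.2 ha)

theorem exists_pos_map_lt (hΦ : IsYoungFunction Φ) {s : ℝ≥0∞} (hs : s ≠ 0) :
    ∃ r : ℝ≥0, 0 < r ∧ Φ r < s := by
  have h1 : ∀ᶠ x in 𝓝[>] (0 : ℝ≥0∞), Φ x < s :=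
    hΦ.tendsto_zero.eventually (gt_mem_nhds (pos_iff_ne_zero.2 hs))
  have h2 : ∀ᶠ x in 𝓝[>] (0 : ℝ≥0∞), x < ∞ :=
    nhdsWithin_le_nhds (gt_mem_nhds ENNReal.zero_lt_top)
  obtain ⟨x, ⟨hx, hx'⟩, hx0⟩ := ((h1.and h2).and self_mem_nhdsWithin).exists
  lift x to ℝ≥0 using hx'.ne
  exact ⟨x, by simpa using hx0, hx⟩

theorem exists_lt_map (hΦ : IsYoungFunction Φ) {s : ℝ≥0∞} (hs : s ≠ ∞) :
    ∃ r : ℝ≥0, s < Φ r := by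
  obtain ⟨a, ha, h⟩ := hΦ.exists_lt_of_lt_map (a := ∞) (by simpa [hΦ.map_top] using hs.lt_top)
  lift a to ℝ≥0 using ha.ne
  exact ⟨a, h⟩

theorem youngInv_ne_zero (hΦ : IsYoungFunction Φ) {s : ℝ≥0∞} (hs : s ≠ 0) :
    youngInv Φ s ≠ 0 := by
  obtain ⟨r, hr, h⟩ := hΦ.exists_pos_map_lt hs
  exact ((by exact_mod_cast hr : (0 : ℝ≥0∞) < r).trans_le (hΦ.le_youngInv h.le)).ne'

theorem youngInv_ne_top (hΦ : IsYoungFunction Φ) {s : ℝ≥0∞} (hs : s ≠ ∞) :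
    youngInv Φ s ≠ ∞ := by
  obtain ⟨r, h⟩ := hΦ.exists_lt_map hs
  exact ne_top_of_le_ne_top ENNReal.coe_ne_top (sInf_le h)

/-- The three-point inequality for a convex function at `x < a < y`, with denominators cleared. -/
theorem sub_mul_map_le (hΦ : IsYoungFunction Φ) {x a y : ℝ≥0} (hxa : x ≤ a) (hay : a < y) :
    ((y - x : ℝ≥0) : ℝ≥0∞) * Φ a ≤ (y - a : ℝ≥0) * Φ x + (a - x : ℝ≥0) * Φ y := by
  have hxy : x < y := hxa.trans_lt hay
  have hd : y - x ≠ 0 := (tsub_pos_of_lt hxy).ne'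
  have hsum : (y - a) / (y - x) + (a - x) / (y - x) = 1 := by
    rw [← add_div, tsub_add_tsub_cancel hay.le hxa, div_self hd]
  have h := hΦ.convexOn.2 (mem_univ (x : ℝ≥0∞)) (mem_univ (y : ℝ≥0∞))
    (zero_le (a := (y - a) / (y - x))) (zero_le (a := (a - x) / (y - x))) hsum
  have hpt : (y - a) / (y - x) * x + (a - x) / (y - x) * y = a := by
    rw [div_mul_eq_mul_div, div_mul_eq_mul_div, ← add_div, div_eq_iff hd]
    apply NNReal.coe_injective
    push_cast [NNReal.coe_sub hay.le, NNReal.coe_sub hxa, NNReal.coe_sub hxy.le]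
    ring
  simp only [ENNReal.smul_def, smul_eq_mul, ← ENNReal.coe_mul, ← ENNReal.coe_add, hpt] at h
  calc ((y - x : ℝ≥0) : ℝ≥0∞) * Φ a
      ≤ (y - x : ℝ≥0) * (((y - a) / (y - x) : ℝ≥0) * Φ x + ((a - x) / (y - x) : ℝ≥0) * Φ y) := by
        gcongr
    _ = _ := by
        rw [mul_add, ← mul_assoc, ← mul_assoc, ← ENNReal.coe_mul, ← ENNReal.coe_mul,
          mul_div_cancel₀ _ hd, mul_div_cancel₀ _ hd]

/-- A Young function is the supremum of the affine functions `r ↦ α r - β` below it. The slope `α`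
is the supremum of the quotients `(b - Φ x) / (a₂ - x)` over `x < a₂`, where `a₂ < a` and `b < Φ
a₂`; as subtraction in `[0,∞]` truncates at `0`, only the `x` with `Φ x < b` contribute, and `α` is
finite. -/
theorem exists_affine_le (hΦ : IsYoungFunction Φ) {a b : ℝ≥0∞} (h : b < Φ a) :
    ∃ α β : ℝ≥0, b + β ≤ α * a ∧ ∀ r, α * r ≤ Φ r + β := by
  obtain ⟨a₂, ha₂, hb₂⟩ := hΦ.exists_lt_of_lt_map h
  obtain ⟨a₁, ha₁, hb₁⟩ := hΦ.exists_lt_of_lt_map hb₂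
  lift a₂ to ℝ≥0 using ha₂.ne_top
  lift a₁ to ℝ≥0 using ha₁.ne_top
  lift b to ℝ≥0 using h.ne_top
  have ha₁' : a₁ < a₂ := by exact_mod_cast ha₁
  let q : ℝ≥0 → ℝ≥0∞ := fun x => (b - Φ x) / (a₂ - x : ℝ≥0)
  let α₀ : ℝ≥0∞ := ⨆ (x : ℝ≥0) (_ : x < a₂), q x
  have hα₀ : α₀ ≤ b / (a₂ - a₁ : ℝ≥0) := by
    refine iSup₂_le fun x hx => ?_
    rcases le_total x a₁ with hxa | hxa
    · simp only [q]
      gcongr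
      exact tsub_le_self
    · have : (b : ℝ≥0∞) - Φ x = 0 :=
        tsub_eq_zero_of_le (hb₁.le.trans (hΦ.monotone (by exact_mod_cast hxa)))
      simp [q, this]
  have hαtop : α₀ ≠ ∞ := by
    refine ne_top_of_le_ne_top (ENNReal.div_ne_top ENNReal.coe_ne_top ?_) hα₀
    exact ENNReal.coe_ne_zero.2 (tsub_pos_of_lt ha₁').ne'
  obtain ⟨α, hα⟩ : ∃ α : ℝ≥0, (α : ℝ≥0∞) = α₀ := ⟨α₀.toNNReal, ENNReal.coe_toNNReal hαtop⟩
  have hle : ∀ x : ℝ≥0, x < a₂ → (b : ℝ≥0∞) ≤ Φ x + α * (a₂ - x : ℝ≥0) := by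
    intro x hx
    have hd : ((a₂ - x : ℝ≥0) : ℝ≥0∞) ≠ 0 := ENNReal.coe_ne_zero.2 (tsub_pos_of_lt hx).ne'
    have h1 : q x ≤ α := hα ▸ le_iSup₂ (f := fun (x : ℝ≥0) (_ : x < a₂) => q x) x hx
    have h2 : (b : ℝ≥0∞) - Φ x ≤ α * (a₂ - x : ℝ≥0) :=
      (ENNReal.div_le_iff hd ENNReal.coe_ne_top).1 h1
    exact tsub_le_iff_left.1 h2
  have hba : b ≤ α * a₂ := by
    have h0 := hle 0 (zero_le.trans_lt ha₁')
    simp only [ENNReal.coe_zero, hΦ.map_zero, zero_add, tsub_zero] at h0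
    exact_mod_cast h0
  have hβ : (b : ℝ≥0∞) + (α * a₂ - b : ℝ≥0) = α * a₂ := by
    rw [← ENNReal.coe_add, add_tsub_cancel_of_le hba, ENNReal.coe_mul]
  refine ⟨α, α * a₂ - b, ?_, fun r => ?_⟩
  · rw [hβ]
    gcongr
  rcases eq_or_ne r ∞ with rfl | hr
  · simp [hΦ.map_top]
  lift r to ℝ≥0 using hr
  suffices H : (b : ℝ≥0∞) + α * r ≤ Φ r + α * a₂ by
    rw [← hβ, add_left_comm] at H
    exact ENNReal.le_of_add_le_add_left ENNReal.coe_ne_top H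
  rcases lt_trichotomy r a₂ with hr | rfl | hr
  · calc (b : ℝ≥0∞) + α * r ≤ Φ r + α * (a₂ - r : ℝ≥0) + α * r := by gcongr; exact hle r hr
      _ = Φ r + α * a₂ := by
        rw [add_assoc, ← mul_add, ← ENNReal.coe_add, tsub_add_cancel_of_le hr.le]
  · gcongr
  · -- beyond `a₂` every left difference quotient is at most the right one, by convexity
    rcases eq_or_ne (Φ r) ∞ with hr' | hr'
    · simp [hr']
    have hslope : (α : ℝ≥0∞) * (r - a₂ : ℝ≥0) ≤ Φ r - b := by
      have hd : ((r - a₂ : ℝ≥0) : ℝ≥0∞) ≠ 0 := ENNReal.coe_ne_zero.2 (tsub_pos_of_lt hr).ne'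
      rw [← ENNReal.le_div_iff_mul_le (Or.inl hd) (Or.inl ENNReal.coe_ne_top), hα]
      refine iSup₂_le fun x hx => ?_
      have hd' : ((a₂ - x : ℝ≥0) : ℝ≥0∞) ≠ 0 := ENNReal.coe_ne_zero.2 (tsub_pos_of_lt hx).ne'
      rw [ENNReal.le_div_iff_mul_le (Or.inl hd) (Or.inl ENNReal.coe_ne_top)]
      simp only [q]
      rw [ENNReal.div_eq_inv_mul, mul_assoc, ENNReal.inv_mul_le_iff hd' ENNReal.coe_ne_top]
      have h3 := hΦ.sub_mul_map_le hx.le hr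
      have hxr : (x : ℝ≥0∞) ≤ r := by exact_mod_cast (hx.trans hr).le
      have h4 : b * ((r - x : ℝ≥0) : ℝ≥0∞) ≤ (r - a₂ : ℝ≥0) * Φ x + (a₂ - x : ℝ≥0) * Φ r := by
        refine le_trans ?_ h3
        rw [mul_comm]
        gcongr
      have hx' : Φ x ≠ ∞ := ne_top_of_le_ne_top hr' (hΦ.monotone hxr)
      have hbr : (b : ℝ≥0∞) ≤ Φ r :=
        (hb₂.trans_le (hΦ.monotone (by exact_mod_cast hr.le))).le
      rcases le_total (b : ℝ≥0∞) (Φ x) with hbx | hbx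
      · simp [tsub_eq_zero_of_le hbx]
      generalize Φ x = p at *
      generalize Φ r = s at *
      lift p to ℝ≥0 using hx'
      lift s to ℝ≥0 using hr'
      norm_cast at h4 hbr hbx ⊢
      rw [← NNReal.coe_le_coe] at h4 ⊢
      push_cast [NNReal.coe_sub hx.le, NNReal.coe_sub hr.le, NNReal.coe_sub (hx.trans hr).le,
        NNReal.coe_sub hbr, NNReal.coe_sub hbx] at h4 ⊢
      linarith
    have hbr : (b : ℝ≥0∞) ≤ Φ r :=
      (hb₂.trans_le (hΦ.monotone (by exact_mod_cast hr.le))).le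
    calc (b : ℝ≥0∞) + α * r = b + α * (r - a₂ : ℝ≥0) + α * a₂ := by
          rw [add_assoc, ← mul_add, ← ENNReal.coe_add, tsub_add_cancel_of_le hr.le]
      _ ≤ b + (Φ r - b) + α * a₂ := by gcongr
      _ = Φ r + α * a₂ := by rw [add_tsub_cancel_of_le hbr]

/-- Jensen's inequality for averages, obtained by integrating the affine minorants of `Φ`; no
measurability of `g` is needed. -/
theorem map_laverage_le (hΦ : IsYoungFunction Φ) {α : Type*} [MeasurableSpace α] {μ : Measure α}
    (hμ0 : μ univ ≠ 0) (hμ : μ univ ≠ ∞) (g : α → ℝ≥0∞) :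
    Φ ((∫⁻ x, g x ∂μ) / μ univ) ≤ (∫⁻ x, Φ (g x) ∂μ) / μ univ := by
  refine le_of_forall_lt fun b hb => ?_
  obtain ⟨b', hbb', hb'⟩ := exists_between hb
  refine hbb'.trans_le ?_
  obtain ⟨α, β, h1, h2⟩ := hΦ.exists_affine_le hb'
  have h3 : α * ∫⁻ x, g x ∂μ ≤ (∫⁻ x, Φ (g x) ∂μ) + β * μ univ := by
    rw [← lintegral_const_mul' _ _ ENNReal.coe_ne_top, ← lintegral_const,
      ← lintegral_add_right _ measurable_const]
    exact lintegral_mono fun x => h2 (g x)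
  have h4 : b' + β ≤ (∫⁻ x, Φ (g x) ∂μ) / μ univ + β :=
    calc b' + β ≤ (α * ∫⁻ x, g x ∂μ) / μ univ := by rwa [mul_div_assoc]
      _ ≤ ((∫⁻ x, Φ (g x) ∂μ) + β * μ univ) / μ univ := by gcongr
      _ = _ := by rw [ENNReal.add_div, ENNReal.mul_div_cancel_right hμ0 hμ]
  exact ENNReal.le_of_add_le_add_right ENNReal.coe_ne_top h4

/-- A Young function dominates a nonzero linear function up to a constant, since it tends to
infinity. -/
theorem exists_linear_le (hΦ : IsYoungFunction Φ) :
    ∃ α β : ℝ≥0, 0 < α ∧ ∀ r, α * r ≤ Φ r + β := by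
  obtain ⟨a, ha⟩ := hΦ.exists_lt_map ENNReal.one_ne_top
  obtain ⟨α, β, h1, h2⟩ := hΦ.exists_affine_le ha
  refine ⟨α, β, pos_iff_ne_zero.2 ?_, h2⟩
  rintro rfl
  simp at h1

end IsYoungFunction

section Maximal

variable {n : ℕ} {ρ : ℝ → ℝ} {Φ Ψ : ℝ≥0∞ → ℝ≥0∞} {𝕜 : Type*} [RCLike 𝕜]

local notation "E" => EuclideanSpace ℝ (Fin n)

/-! ### Maximal functions and the weak type inequality -/

theorem volume_ball_eq (x : E) {r : ℝ} (hr : 0 < r) :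
    volume (Metric.ball x r) = ENNReal.ofReal (r ^ n) * volume (Metric.ball (0 : E) 1) := by
  simpa using Measure.addHaar_ball_of_pos volume x hr

theorem volume_ball_ne_zero (x : E) {r : ℝ} (hr : 0 < r) : volume (Metric.ball x r) ≠ 0 :=
  (Metric.measure_ball_pos volume x hr).ne'

theorem volume_ball_ne_top (x : E) {r : ℝ} : volume (Metric.ball x r) ≠ ∞ :=
  measure_ball_lt_top.ne

theorem lowerSemicontinuous_setLIntegral_ball (g : E → ℝ≥0∞) (r : ℝ) :
    LowerSemicontinuous fun x : E => ∫⁻ y in Metric.ball x r, g y := by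
  intro x c hc
  -- the open ball is the increasing union of the concentric balls of smaller radius
  have hU : Metric.ball x r = ⋃ k : ℕ, Metric.ball x (r - 1 / (k + 1)) := by
    ext y
    simp only [Metric.mem_ball, mem_iUnion]
    constructor
    · intro h
      obtain ⟨k, hk⟩ := exists_nat_one_div_lt (sub_pos.2 h)
      exact ⟨k, by linarith⟩
    · rintro ⟨k, hk⟩
      have : (0 : ℝ) < 1 / (k + 1) := by positivity
      linarith
  have hmono : Monotone fun k : ℕ => Metric.ball x (r - 1 / ((k : ℝ) + 1)) := by
    intro k l hkl
    refine Metric.ball_subset_ball ?_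
    have : 1 / ((l : ℝ) + 1) ≤ 1 / ((k : ℝ) + 1) := by gcongr
    linarith
  change c < ∫⁻ y in Metric.ball x r, g y at hc
  rw [hU, setLIntegral_iUnion_of_directed _ hmono.directed_le, lt_iSup_iff] at hc
  obtain ⟨k, hk⟩ := hc
  have hpos : (0 : ℝ) < 1 / (k + 1) := by positivity
  filter_upwards [Metric.ball_mem_nhds x hpos] with x' hx'
  refine hk.trans_le (lintegral_mono_set (Metric.ball_subset_ball' ?_))
  rw [Metric.mem_ball, dist_comm] at hx'
  linarith

theorem lowerSemicontinuous_fracMaximal (ρ : ℝ → ℝ) (g : E → ℝ≥0∞) :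
    LowerSemicontinuous (fracMaximal ρ g) := by
  unfold fracMaximal
  refine lowerSemicontinuous_iSup fun r => lowerSemicontinuous_iSup fun hr => ?_
  simp only [enorm_eq_self, volume_ball_eq _ hr]
  have hc : ENNReal.ofReal (ρ r) /
      (ENNReal.ofReal (r ^ n) * volume (Metric.ball (0 : E) 1)) ≠ ∞ := by
    rw [← volume_ball_eq 0 hr]
    exact ENNReal.div_ne_top ENNReal.ofReal_ne_top (volume_ball_ne_zero _ hr)
  exact (ENNReal.continuous_const_mul hc).comp_lowerSemicontinuous
    (lowerSemicontinuous_setLIntegral_ball g r) fun _ _ h => mul_le_mul' le_rfl h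

theorem fracMaximal_enorm {F : Type*} [ENorm F] (ρ : ℝ → ℝ) (f : E → F) :
    fracMaximal ρ (fun y => ‖f y‖ₑ) = fracMaximal ρ f := by
  ext x
  simp [fracMaximal]

theorem measurable_fracMaximal (ρ : ℝ → ℝ) {F : Type*} [ENorm F] (f : E → F) :
    Measurable (fracMaximal ρ f) := by
  rw [← fracMaximal_enorm]
  exact (lowerSemicontinuous_fracMaximal ρ _).measurable

theorem fracMaximal_const_mul (ρ : ℝ → ℝ) {c : ℝ≥0∞} (hc : c ≠ ∞) (g : E → ℝ≥0∞) (x : E) :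
    fracMaximal ρ (fun y => c * g y) x = c * fracMaximal ρ g x := by
  simp only [fracMaximal, enorm_eq_self, lintegral_const_mul' _ _ hc, ENNReal.mul_iSup,
    mul_left_comm c]

theorem fracMaximal_one_eq (g : E → ℝ≥0∞) (x : E) : fracMaximal (fun _ => 1) g x =
    ⨆ (r : ℝ) (_ : 0 < r), (∫⁻ y in Metric.ball x r, g y) / volume (Metric.ball x r) := by
  simp [fracMaximal, ENNReal.div_eq_inv_mul]

/-- The weak type `(1,1)` inequality for the Hardy–Littlewood maximal operator, by the Vitali
covering lemma. -/
theorem mul_volume_lt_fracMaximal_one_le (hn : 1 ≤ n) (g : E → ℝ≥0∞) (t : ℝ≥0) :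
    t * volume {x | (t : ℝ≥0∞) < fracMaximal (fun _ => 1) g x} ≤ 5 ^ n * ∫⁻ y, g y := by
  rcases eq_or_ne t 0 with rfl | ht
  · simp
  rcases eq_or_ne (∫⁻ y, g y) ∞ with hg | hg
  · simp [hg]
  set S := {x | (t : ℝ≥0∞) < fracMaximal (fun _ => 1) g x} with hS
  have hex : ∀ x ∈ S, ∃ r : ℝ, 0 < r ∧
      t * volume (Metric.ball x r) ≤ ∫⁻ y in Metric.ball x r, g y := by
    intro x hx
    rw [hS, mem_ofPred_eq, fracMaximal_one_eq] at hx
    simp only [lt_iSup_iff] at hx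
    obtain ⟨r, hr, h⟩ := hx
    exact ⟨r, hr, ((ENNReal.lt_div_iff_mul_lt (Or.inl (volume_ball_ne_zero x hr))
      (Or.inl (volume_ball_ne_top x))).1 h).le⟩
  choose! r hr0 hr using hex
  set v := volume (Metric.ball (0 : E) 1)
  have hv0 : v ≠ 0 := volume_ball_ne_zero 0 one_pos
  have ht' : (t : ℝ≥0∞) ≠ 0 := by simpa using ht
  -- the radii are bounded because `g` has finite integral, so the Vitali lemma applies
  have hbound : ∀ x ∈ S, r x ≤ max 1 ((∫⁻ y, g y) / (t * v)).toReal := by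
    intro x hx
    rcases le_total (r x) 1 with h1 | h1
    · exact h1.trans (le_max_left _ _)
    refine le_trans ?_ (le_max_right _ _)
    have h2 : ENNReal.ofReal (r x) ≤ (∫⁻ y, g y) / (t * v) := by
      rw [ENNReal.le_div_iff_mul_le (Or.inl (mul_ne_zero ht' hv0))
        (Or.inl (ENNReal.mul_ne_top ENNReal.coe_ne_top (volume_ball_ne_top _)))]
      calc ENNReal.ofReal (r x) * (t * v) ≤ ENNReal.ofReal (r x ^ n) * (t * v) := by
            gcongr
            exact le_self_pow₀ h1 (by omega)
        _ = t * volume (Metric.ball x (r x)) := by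
            rw [volume_ball_eq x (hr0 x hx)]; ring
        _ ≤ ∫⁻ y in Metric.ball x (r x), g y := hr x hx
        _ ≤ ∫⁻ y, g y := setLIntegral_le_lintegral _ _
    exact (ENNReal.ofReal_le_iff_le_toReal
      (ENNReal.div_ne_top hg (mul_ne_zero ht' hv0))).1 h2
  obtain ⟨u, huS, hdisj, hcov⟩ := Vitali.exists_disjoint_subfamily_covering_enlargement_closedBall
    S id r _ hbound 5 (by norm_num)
  have hdisj' : u.PairwiseDisjoint fun a => Metric.ball a (r a) :=
    hdisj.mono fun a => Metric.ball_subset_closedBall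
  have hcount : u.Countable := hdisj'.countable_of_isOpen (fun _ _ => Metric.isOpen_ball)
    fun a ha => Metric.nonempty_ball.2 (hr0 a (huS ha))
  have hSsub : S ⊆ ⋃ b ∈ u, Metric.closedBall b (5 * r b) := by
    intro x hx
    obtain ⟨b, hb, hsub⟩ := hcov x hx
    exact mem_biUnion hb (hsub (Metric.mem_closedBall_self (hr0 x hx).le))
  have : Countable u := hcount.to_subtype
  calc t * volume S ≤ t * ∑' b : u, volume (Metric.closedBall (b : E) (5 * r b)) := by
        gcongr
        exact (measure_mono hSsub).trans (measure_biUnion_le _ hcount _)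
    _ = ∑' b : u, 5 ^ n * (t * volume (Metric.ball (b : E) (r b))) := by
        rw [← ENNReal.tsum_mul_left]
        refine tsum_congr fun b => ?_
        have hb := hr0 b (huS b.2)
        rw [Measure.addHaar_closedBall _ _ (by positivity), volume_ball_eq _ hb,
          finrank_euclideanSpace, Fintype.card_fin, mul_pow, ENNReal.ofReal_mul (by positivity),
          ENNReal.ofReal_pow (by norm_num)]
        simp only [ENNReal.ofReal_ofNat]
        ring
    _ ≤ ∑' b : u, 5 ^ n * ∫⁻ y in Metric.ball (b : E) (r b), g y := by
        gcongr with b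
        exact hr b (huS b.2)
    _ = 5 ^ n * ∫⁻ y in ⋃ b ∈ u, Metric.ball b (r b), g y := by
        rw [ENNReal.tsum_mul_left,
          lintegral_biUnion hcount (fun b _ => Metric.isOpen_ball.measurableSet) hdisj']
    _ ≤ 5 ^ n * ∫⁻ y, g y := by
        gcongr
        exact Measure.restrict_le_self

/-- The weak type inequality at height `t` only sees the part of `g` above `t / 2`: the rest
contributes at most `t / 2` to every average. -/
theorem mul_volume_lt_fracMaximal_one_le_indicator (hn : 1 ≤ n) (g : E → ℝ≥0∞) (t : ℝ≥0) :
    t * volume {x | (t : ℝ≥0∞) < fracMaximal (fun _ => 1) g x} ≤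
      2 * 5 ^ n * ∫⁻ y, {z | (t : ℝ≥0∞) < 2 * g z}.indicator g y := by
  set g' := {z | (t : ℝ≥0∞) < 2 * g z}.indicator g with hg'
  have hle : ∀ y, g y ≤ g' y + (t / 2 : ℝ≥0) := by
    intro y
    by_cases hy : (t : ℝ≥0∞) < 2 * g y
    · simp [hg', indicator_of_mem (show y ∈ {z | (t : ℝ≥0∞) < 2 * g z} from hy)]
    · rw [not_lt, mul_comm] at hy
      refine le_add_left ?_
      rw [ENNReal.coe_div two_ne_zero]
      exact (ENNReal.le_div_iff_mul_le (by simp) (by simp)).2 (by simpa using hy)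
  have hmax : ∀ x, fracMaximal (fun _ => 1) g x ≤
      fracMaximal (fun _ => 1) g' x + (t / 2 : ℝ≥0) := by
    intro x
    rw [fracMaximal_one_eq, fracMaximal_one_eq]
    refine iSup₂_le fun r hr => ?_
    have hB0 := volume_ball_ne_zero x hr
    have hB1 := volume_ball_ne_top x (r := r)
    calc (∫⁻ y in Metric.ball x r, g y) / volume (Metric.ball x r)
        ≤ (∫⁻ y in Metric.ball x r, (g' y + (t / 2 : ℝ≥0))) / volume (Metric.ball x r) := by
          gcongr with y
          exact hle y
      _ = (∫⁻ y in Metric.ball x r, g' y) / volume (Metric.ball x r) + (t / 2 : ℝ≥0) := by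
          rw [lintegral_add_right _ measurable_const, setLIntegral_const, ENNReal.add_div,
            ENNReal.mul_div_cancel_right hB0 hB1]
      _ ≤ _ := by
          gcongr
          exact le_iSup₂ (f := fun (r : ℝ) (_ : 0 < r) =>
            (∫⁻ y in Metric.ball x r, g' y) / volume (Metric.ball x r)) r hr
  have hsub : {x | (t : ℝ≥0∞) < fracMaximal (fun _ => 1) g x} ⊆
      {x | ((t / 2 : ℝ≥0) : ℝ≥0∞) < fracMaximal (fun _ => 1) g' x} := by
    intro x hx
    have h1 : ((t / 2 : ℝ≥0) : ℝ≥0∞) + (t / 2 : ℝ≥0) <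
        fracMaximal (fun _ => 1) g' x + (t / 2 : ℝ≥0) := by
      rw [← ENNReal.coe_add, add_halves]
      exact lt_of_lt_of_le hx (hmax x)
    exact (ENNReal.add_lt_add_iff_right ENNReal.coe_ne_top).1 h1
  calc t * volume {x | (t : ℝ≥0∞) < fracMaximal (fun _ => 1) g x}
      ≤ t * volume {x | ((t / 2 : ℝ≥0) : ℝ≥0∞) < fracMaximal (fun _ => 1) g' x} := by gcongr
    _ = 2 * ((t / 2 : ℝ≥0) *
        volume {x | ((t / 2 : ℝ≥0) : ℝ≥0∞) < fracMaximal (fun _ => 1) g' x}) := by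
        have ht : (t : ℝ≥0∞) = 2 * (t / 2 : ℝ≥0) := by
          exact_mod_cast (mul_div_cancel₀ t two_ne_zero).symm
        rw [← mul_assoc, ← ht]
    _ ≤ 2 * (5 ^ n * ∫⁻ y, g' y) :=
        mul_le_mul' le_rfl (mul_volume_lt_fracMaximal_one_le hn g' _)
    _ = _ := by rw [mul_assoc]

/-! ### Pointwise estimates -/

/-- The form in which the condition on `ρ` is used. If `Φ b ≤ r⁻ⁿ`, then every `u` in
`[Φ b, r⁻ⁿ]` other than `0` is `r'⁻ⁿ` with `r' ≥ r`, and the condition at `r'` bounds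
`Ψ (ρ(r) b / C)` by `u`. Letting `u` decrease to `Φ b` also covers the case `Φ b = 0`. -/
theorem map_mul_div_le_map (hn : 1 ≤ n) (hΦ : IsYoungFunction Φ) (hΨ : IsYoungFunction Ψ)
    (hρ : MonotoneOn ρ (Ioi 0)) {C : ℝ≥0} (hC0 : 0 < C)
    (hC : ∀ r : ℝ, 0 < r → ENNReal.ofReal (ρ r) ≤
      C * (youngInv Ψ (ENNReal.ofReal (r ^ (-(n : ℤ)))) /
        youngInv Φ (ENNReal.ofReal (r ^ (-(n : ℤ))))))
    {r : ℝ} (hr : 0 < r) {b : ℝ≥0∞} (hb : Φ b ≤ ENNReal.ofReal (r ^ (-(n : ℤ)))) :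
    Ψ (ENNReal.ofReal (ρ r) * b / C) ≤ Φ b := by
  refine le_of_forall_gt_imp_ge_of_dense fun e he => ?_
  have hs0 : 0 < r ^ (-(n : ℤ)) := zpow_pos hr _
  set u := min e (ENNReal.ofReal (r ^ (-(n : ℤ)))) with hu
  have hu0 : u ≠ 0 :=
    (lt_min (bot_le.trans_lt he) (ENNReal.ofReal_pos.2 hs0)).ne'
  have hutop : u ≠ ∞ := ne_top_of_le_ne_top ENNReal.ofReal_ne_top (min_le_right _ _)
  have hbu : Φ b ≤ u := le_min he.le hb
  have hu' : 0 < u.toReal := ENNReal.toReal_pos hu0 hutop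
  set r' : ℝ := u.toReal⁻¹ ^ ((n : ℝ)⁻¹) with hr'
  have hr'0 : 0 < r' := Real.rpow_pos_of_pos (inv_pos.2 hu') _
  have hr'n : r' ^ n = u.toReal⁻¹ :=
    Real.rpow_inv_natCast_pow (inv_pos.2 hu').le (by omega)
  have hur : ENNReal.ofReal (r' ^ (-(n : ℤ))) = u := by
    rw [zpow_neg, zpow_natCast, hr'n, inv_inv, ENNReal.ofReal_toReal hutop]
  have hrr' : r ≤ r' := by
    rw [← pow_le_pow_iff_left₀ hr.le hr'0.le (show n ≠ 0 by omega), hr'n,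
      le_inv_comm₀ (pow_pos hr n) hu', ← zpow_natCast, ← zpow_neg]
    exact ENNReal.toReal_le_of_le_ofReal hs0.le (min_le_right _ _)
  have hC' := hC r' hr'0
  rw [hur] at hC'
  have hmain : ENNReal.ofReal (ρ r) * b ≤ C * youngInv Ψ u :=
    calc ENNReal.ofReal (ρ r) * b ≤ ENNReal.ofReal (ρ r') * youngInv Φ u := by
          gcongr
          · exact hρ hr hr'0 hrr'
          · exact hΦ.le_youngInv hbu
      _ ≤ C * (youngInv Ψ u / youngInv Φ u) * youngInv Φ u := by gcongr
      _ = C * youngInv Ψ u := by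
          rw [mul_assoc, ENNReal.div_mul_cancel (hΦ.youngInv_ne_zero hu0)
            (hΦ.youngInv_ne_top hutop)]
  have hC0' : (C : ℝ≥0∞) ≠ 0 := by simpa using hC0.ne'
  calc Ψ (ENNReal.ofReal (ρ r) * b / C) ≤ Ψ (youngInv Ψ u) :=
        hΨ.monotone (ENNReal.div_le_of_le_mul' hmain)
    _ ≤ u := hΨ.map_youngInv_le u
    _ ≤ e := min_le_left _ _

/-- The pointwise (Hedberg-type) estimates behind the sufficiency of the condition on `ρ`. -/
theorem exists_map_fracMaximal_le (hn : 1 ≤ n) (hΦ : IsYoungFunction Φ) (hΨ : IsYoungFunction Ψ)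
    (hρ : MonotoneOn ρ (Ioi 0)) (hcond : RhoCondition n ρ Φ Ψ) :
    ∃ κ : ℝ≥0, 0 < κ ∧ ∀ h : E → ℝ≥0∞, ∫⁻ y, Φ (h y) ≤ 1 → ∀ x,
      Ψ (κ * fracMaximal ρ h x) ≤ Φ (fracMaximal (fun _ => 1) h x) ∧
      Ψ (κ * fracMaximal ρ h x) ≤ fracMaximal (fun _ => 1) (fun y => Φ (h y)) x := by
  obtain ⟨C, hC0, hC⟩ := hcond
  obtain ⟨v, hv⟩ : ∃ v : ℝ≥0, (v : ℝ≥0∞) = volume (Metric.ball (0 : E) 1) :=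
    ⟨_, ENNReal.coe_toNNReal (volume_ball_ne_top _)⟩
  have hv0 : 0 < v := by
    rw [← ENNReal.coe_pos, hv]
    exact pos_iff_ne_zero.2 (volume_ball_ne_zero 0 one_pos)
  -- the factor `min 1 v` compensates for `r⁻ⁿ` in place of `1 / |B(x, r)|` in the condition
  set c : ℝ≥0 := min 1 v with hc
  have hc0 : 0 < c := lt_min one_pos hv0
  refine ⟨c / C, by positivity, fun h hh x => ?_⟩
  have key : ∀ r : ℝ, 0 < r →
      Ψ ((c / C : ℝ≥0) * (ENNReal.ofReal (ρ r) / volume (Metric.ball x r) *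
        ∫⁻ y in Metric.ball x r, ‖h y‖ₑ)) ≤
      Φ ((∫⁻ y in Metric.ball x r, h y) / volume (Metric.ball x r)) ∧
      Φ ((∫⁻ y in Metric.ball x r, h y) / volume (Metric.ball x r)) ≤
        (∫⁻ y in Metric.ball x r, Φ (h y)) / volume (Metric.ball x r) := by
    intro r hr
    have hB0 := volume_ball_ne_zero x hr
    have hB1 := volume_ball_ne_top x (r := r)
    set a := (∫⁻ y in Metric.ball x r, h y) / volume (Metric.ball x r) with ha
    have hJ : Φ a ≤ (∫⁻ y in Metric.ball x r, Φ (h y)) / volume (Metric.ball x r) := by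
      have := hΦ.map_laverage_le (μ := volume.restrict (Metric.ball x r))
        (by simpa using hB0) (by simpa using hB1) h
      simpa [ha] using this
    have hca : Φ (c * a) ≤ ENNReal.ofReal (r ^ (-(n : ℤ))) :=
      calc Φ (c * a) ≤ c * Φ a := hΦ.map_mul_le (min_le_left _ _) a
        _ ≤ v * (1 / volume (Metric.ball x r)) := by
            gcongr
            · exact min_le_right _ _
            · refine hJ.trans ?_
              gcongr
              exact (setLIntegral_le_lintegral _ _).trans hh
        _ = ENNReal.ofReal (r ^ (-(n : ℤ))) := by
            rw [volume_ball_eq x hr, ← hv, zpow_neg, zpow_natCast,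
              ENNReal.ofReal_inv_of_pos (pow_pos hr n), one_div,
              ENNReal.mul_inv (Or.inr ENNReal.coe_ne_top) (Or.inl ENNReal.ofReal_ne_top),
              mul_left_comm, ENNReal.mul_inv_cancel (by simpa using hv0.ne') ENNReal.coe_ne_top,
              mul_one]
    refine ⟨?_, hJ⟩
    have h1 := map_mul_div_le_map hn hΦ hΨ hρ hC0 hC hr hca
    have h2 : ((c / C : ℝ≥0) : ℝ≥0∞) * (ENNReal.ofReal (ρ r) / volume (Metric.ball x r) *
        ∫⁻ y in Metric.ball x r, ‖h y‖ₑ) = ENNReal.ofReal (ρ r) * (c * a) / C := by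
      rw [ENNReal.coe_div hC0.ne', ha]
      simp only [enorm_eq_self, div_eq_mul_inv]
      ring
    rw [h2]
    refine h1.trans (hΦ.monotone ?_)
    calc (c : ℝ≥0∞) * a ≤ 1 * a := by gcongr; exact_mod_cast min_le_left 1 v
      _ = a := one_mul a
  rw [fracMaximal_one_eq, fracMaximal_one_eq]
  unfold fracMaximal
  simp only [ENNReal.mul_iSup]
  refine ⟨hΨ.map_iSup_le fun r => hΨ.map_iSup_le fun hr => (key r hr).1.trans (hΦ.monotone ?_),
    hΨ.map_iSup_le fun r => hΨ.map_iSup_le fun hr => ((key r hr).1.trans (key r hr).2).trans ?_⟩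
  · exact le_iSup₂ (f := fun (r : ℝ) (_ : 0 < r) =>
      (∫⁻ y in Metric.ball x r, h y) / volume (Metric.ball x r)) r hr
  · exact le_iSup₂ (f := fun (r : ℝ) (_ : 0 < r) =>
      (∫⁻ y in Metric.ball x r, Φ (h y)) / volume (Metric.ball x r)) r hr

/-! ### The maximal operator under the `∇₂`-condition -/

/-- The `∇₂`-condition, iterated. -/
theorem map_inv_pow_mul_le {C : ℝ≥0} (hC : 1 < C)
    (h : ∀ r : ℝ≥0, Φ r ≤ Φ (C * r) / (2 * C)) (j : ℕ) (r : ℝ≥0) :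
    Φ ((C⁻¹ ^ j * r : ℝ≥0)) ≤ (((2 * C)⁻¹ ^ j : ℝ≥0) : ℝ≥0∞) * Φ r := by
  have hC0 : C ≠ 0 := (one_pos.trans hC).ne'
  induction j with
  | zero => simp
  | succ j ih =>
    have h1 := h (C⁻¹ ^ (j + 1) * r)
    rw [← ENNReal.coe_mul, pow_succ', mul_assoc, mul_inv_cancel_left₀ hC0] at h1
    rw [pow_succ', mul_assoc]
    refine h1.trans ?_
    rw [ENNReal.div_eq_inv_mul, pow_succ', ENNReal.coe_mul (2 * C)⁻¹, mul_assoc,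
      ENNReal.coe_inv (mul_ne_zero two_ne_zero hC0), ENNReal.coe_mul 2 C, ENNReal.coe_ofNat]
    gcongr

/-- The dyadic-type sum arising from the layer decomposition of the maximal function along the
levels `C ^ k`: by `∇₂` it is dominated by a geometric series, hence by its largest term. -/
theorem tsum_zpow_le (hΦ : IsYoungFunction Φ) {C : ℝ≥0} (hC : 1 < C)
    (h : ∀ r : ℝ≥0, Φ r ≤ Φ (C * r) / (2 * C)) (K : ℝ≥0) {z : ℝ≥0∞} (hz : z ≠ ∞) :
    ∑' k : ℤ, Φ ((C ^ (k + 1) / K : ℝ≥0)) * (((C ^ k)⁻¹ : ℝ≥0) *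
      (if ((C ^ k : ℝ≥0) : ℝ≥0∞) < 2 * z then z else 0)) ≤ C * Φ ((2 * C / K : ℝ≥0) * z) := by
  have hC0 : C ≠ 0 := (one_pos.trans hC).ne'
  rcases eq_or_ne z 0 with rfl | hz0
  · simp
  lift z to ℝ≥0 using hz
  have hz0' : z ≠ 0 := by simpa using hz0
  obtain ⟨k₀, hk₀, hk₀'⟩ := NNReal.exists_mem_Ioc_zpow (mul_ne_zero two_ne_zero hz0') hC
  have hcast : ∀ k : ℤ, (((C ^ k : ℝ≥0) : ℝ≥0∞) < 2 * z) ↔ C ^ k < 2 * z := by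
    intro k
    exact_mod_cast Iff.rfl
  have hinj : Function.Injective fun j : ℕ => k₀ - (j : ℤ) := by
    intro i j hij
    simpa using hij
  rw [← hinj.tsum_eq]
  · calc ∑' j : ℕ, Φ ((C ^ (k₀ - (j : ℤ) + 1) / K : ℝ≥0)) * (((C ^ (k₀ - (j : ℤ)))⁻¹ : ℝ≥0) *
          (if ((C ^ (k₀ - (j : ℤ)) : ℝ≥0) : ℝ≥0∞) < 2 * z then (z : ℝ≥0∞) else 0))
        ≤ ∑' j : ℕ, ((2⁻¹ : ℝ≥0∞) ^ j * (Φ ((C ^ (k₀ + 1) / K : ℝ≥0)) *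
            ((C ^ k₀)⁻¹ * z : ℝ≥0))) := by
          refine ENNReal.tsum_le_tsum fun j => ?_
          have harg : C ^ (k₀ - (j : ℤ) + 1) / K = C⁻¹ ^ j * (C ^ (k₀ + 1) / K) := by
            rw [show k₀ - (j : ℤ) + 1 = -(j : ℤ) + (k₀ + 1) by ring, zpow_add₀ hC0, zpow_neg,
              zpow_natCast, inv_pow, mul_div_assoc]
          have hcoef : (2 * C)⁻¹ ^ j * ((C ^ (k₀ - (j : ℤ)))⁻¹ * z) =
              2⁻¹ ^ j * ((C ^ k₀)⁻¹ * z) := by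
            rw [zpow_sub₀ hC0, zpow_natCast, mul_inv, mul_pow, inv_div, inv_pow C]
            field_simp
          rw [harg]
          calc _ ≤ (((2 * C)⁻¹ ^ j : ℝ≥0) : ℝ≥0∞) * Φ ((C ^ (k₀ + 1) / K : ℝ≥0)) *
                (((C ^ (k₀ - (j : ℤ)))⁻¹ : ℝ≥0) * z) := by
                gcongr
                · exact map_inv_pow_mul_le hC h j _
                · split_ifs <;> simp
            _ = Φ ((C ^ (k₀ + 1) / K : ℝ≥0)) *
                ((2 * C)⁻¹ ^ j * ((C ^ (k₀ - (j : ℤ)))⁻¹ * z) : ℝ≥0) := by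
                push_cast
                ring
            _ = _ := by
                rw [hcoef, ENNReal.coe_mul, ENNReal.coe_pow, ENNReal.coe_inv two_ne_zero,
                  ENNReal.coe_ofNat]
                ring
      _ = 2 * (Φ ((C ^ (k₀ + 1) / K : ℝ≥0)) * ((C ^ k₀)⁻¹ * z : ℝ≥0)) := by
          rw [ENNReal.tsum_mul_right, ENNReal.tsum_geometric, ENNReal.one_sub_inv_two, inv_inv]
      _ = (2 * ((C ^ k₀)⁻¹ * z) : ℝ≥0) * Φ ((C ^ (k₀ + 1) / K : ℝ≥0)) := by
          push_cast
          ring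
      _ ≤ C * Φ ((2 * C / K : ℝ≥0) * z) := by
          have hCk : 0 < C ^ k₀ := zpow_pos (one_pos.trans hC) _
          gcongr
          · rw [mul_left_comm, inv_mul_le_iff₀ hCk, ← zpow_add_one₀ hC0]
            exact hk₀'
          · refine hΦ.monotone ?_
            rw [← ENNReal.coe_mul]
            refine ENNReal.coe_le_coe.2 ?_
            rw [zpow_add_one₀ hC0, div_mul_eq_mul_div]
            gcongr ?_ / K
            calc C ^ k₀ * C ≤ 2 * z * C := by gcongr
              _ = 2 * C * z := by ring
  · intro k hk
    by_contra hk'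
    refine hk ?_
    have hlt : k₀ < k := by
      by_contra! hle
      exact hk' ⟨(k₀ - k).toNat, by simp [hle]⟩
    have : ¬ C ^ k < 2 * z := by
      rw [not_lt]
      exact hk₀'.trans (zpow_le_zpow_right₀ hC.le (by omega))
    simp [hcast, this]

/-- The Hardy–Littlewood maximal operator is bounded on the Orlicz space of a `∇₂` Young function,
in modular form. -/
theorem exists_lintegral_map_fracMaximal_one_le (hn : 1 ≤ n) (hΦ : IsYoungFunction Φ)
    (hN : Nabla2 Φ) :
    ∃ K : ℝ≥0, 1 ≤ K ∧ ∀ h : E → ℝ≥0∞, AEMeasurable h → (∀ y, h y ≠ ∞) →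
      ∫⁻ y, Φ (h y) ≤ 1 → ∫⁻ x, Φ (fracMaximal (fun _ => 1) h x / K) ≤ 1 := by
  obtain ⟨C, hC, hCΦ⟩ := hN
  have hC0 : 0 < C := one_pos.trans hC
  set D : ℝ≥0 := 2 * 5 ^ n with hD
  have hD1 : 1 ≤ D := by
    have : (1 : ℝ≥0) ≤ 5 ^ n := one_le_pow₀ (by norm_num)
    calc (1 : ℝ≥0) ≤ 2 * 1 := by norm_num
      _ ≤ D := by rw [hD]; gcongr
  have hDC : 1 ≤ D * C := one_le_mul hD1 hC.le
  -- the factor `2 * C` absorbs the rounding of `2 * h` up to a power of `C`, and `D * C` is the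
  -- constant in front of the resulting integral
  set K : ℝ≥0 := 2 * C * (D * C) with hK
  have hK0 : 0 < K := by positivity
  have h2C : 1 ≤ 2 * C := one_le_mul (by norm_num) hC.le
  refine ⟨K, one_le_mul h2C hDC, fun h hm hfin hint => ?_⟩
  set M := fracMaximal (fun _ => 1) h with hM
  have hMm : Measurable M := measurable_fracMaximal _ h
  have hKtop : (K : ℝ≥0∞) ≠ ∞ := ENNReal.coe_ne_top
  have hK0' : (K : ℝ≥0∞) ≠ 0 := by simpa using hK0.ne'
  -- where `M x = ∞` the sum is infinite as well, so no separate argument for `M < ∞` a.e. is needed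
  have hlayer : ∀ x, Φ (M x / K) ≤ ∑' k : ℤ,
      {x | ((C ^ k : ℝ≥0) : ℝ≥0∞) < M x}.indicator (fun _ => Φ ((C ^ (k + 1) / K : ℝ≥0))) x := by
    intro x
    refine le_of_forall_lt fun b hb => ?_
    obtain ⟨a, ha, hba⟩ := hΦ.exists_lt_of_lt_map hb
    lift a to ℝ≥0 using ha.ne_top
    have ha0 : a ≠ 0 := by
      rintro rfl
      simp [hΦ.map_zero] at hba
    obtain ⟨k, hk, hk'⟩ := NNReal.exists_mem_Ioc_zpow (mul_ne_zero ha0 hK0.ne') hC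
    have haM : ((a * K : ℝ≥0) : ℝ≥0∞) < M x := by
      rw [ENNReal.coe_mul]
      exact (ENNReal.lt_div_iff_mul_lt (Or.inl hK0') (Or.inl hKtop)).1 ha
    have hmem : x ∈ {x | ((C ^ k : ℝ≥0) : ℝ≥0∞) < M x} :=
      (ENNReal.coe_lt_coe.2 hk).trans haM
    refine lt_of_lt_of_le ?_ (ENNReal.le_tsum k)
    rw [indicator_of_mem hmem]
    refine hba.trans_le (hΦ.monotone (ENNReal.coe_le_coe.2 ?_))
    rwa [le_div_iff₀ hK0]
  have hweak : ∀ k : ℤ, volume {x | ((C ^ k : ℝ≥0) : ℝ≥0∞) < M x} ≤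
      ((C ^ k)⁻¹ : ℝ≥0) * (D * ∫⁻ y, {z | ((C ^ k : ℝ≥0) : ℝ≥0∞) < 2 * h z}.indicator h y) := by
    intro k
    have hk : C ^ k ≠ 0 := (zpow_pos hC0 k).ne'
    have := mul_volume_lt_fracMaximal_one_le_indicator hn h (C ^ k)
    rw [ENNReal.coe_inv hk, ← ENNReal.mul_le_iff_le_inv (by simpa using hk) ENNReal.coe_ne_top]
    simpa [hD] using this
  have hset : ∀ k : ℤ, NullMeasurableSet {z | ((C ^ k : ℝ≥0) : ℝ≥0∞) < 2 * h z} :=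
    fun k => nullMeasurableSet_lt aemeasurable_const (hm.const_mul 2)
  calc ∫⁻ x, Φ (M x / K)
      ≤ ∫⁻ x, ∑' k : ℤ, {x | ((C ^ k : ℝ≥0) : ℝ≥0∞) < M x}.indicator
          (fun _ => Φ ((C ^ (k + 1) / K : ℝ≥0))) x := lintegral_mono hlayer
    _ = ∑' k : ℤ, Φ ((C ^ (k + 1) / K : ℝ≥0)) *
          volume {x | ((C ^ k : ℝ≥0) : ℝ≥0∞) < M x} := by
        have hs : ∀ k : ℤ, MeasurableSet {x | ((C ^ k : ℝ≥0) : ℝ≥0∞) < M x} :=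
          fun k => measurableSet_lt measurable_const hMm
        rw [lintegral_tsum fun k => (measurable_const.indicator (hs k)).aemeasurable]
        exact tsum_congr fun k => lintegral_indicator_const (hs k) _
    _ ≤ ∑' k : ℤ, Φ ((C ^ (k + 1) / K : ℝ≥0)) * (((C ^ k)⁻¹ : ℝ≥0) *
          (D * ∫⁻ y, {z | ((C ^ k : ℝ≥0) : ℝ≥0∞) < 2 * h z}.indicator h y)) := by
        gcongr with k
        exact hweak k
    _ = D * ∑' k : ℤ, ∫⁻ y, Φ ((C ^ (k + 1) / K : ℝ≥0)) * (((C ^ k)⁻¹ : ℝ≥0) *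
          {z | ((C ^ k : ℝ≥0) : ℝ≥0∞) < 2 * h z}.indicator h y) := by
        rw [← ENNReal.tsum_mul_left]
        refine tsum_congr fun k => ?_
        have hmk := hm.indicator₀ (hset k)
        rw [lintegral_const_mul'' _ (hmk.const_mul _), lintegral_const_mul'' _ hmk]
        ring
    _ = D * ∫⁻ y, ∑' k : ℤ, Φ ((C ^ (k + 1) / K : ℝ≥0)) * (((C ^ k)⁻¹ : ℝ≥0) *
          {z | ((C ^ k : ℝ≥0) : ℝ≥0∞) < 2 * h z}.indicator h y) := by
        rw [lintegral_tsum fun k => ((hm.indicator₀ (hset k)).const_mul _).const_mul _]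
    _ ≤ D * ∫⁻ y, (D * C : ℝ≥0)⁻¹ * (C * Φ (h y)) := by
        gcongr with y
        simp only [indicator_apply, mem_ofPred_eq]
        refine (tsum_zpow_le hΦ hC hCΦ K (hfin y)).trans ?_
        have hθ : 2 * C / K = (D * C)⁻¹ := by
          rw [hK]
          field_simp
        rw [hθ, mul_left_comm]
        gcongr
        exact hΦ.map_mul_le (inv_le_one_of_one_le₀ hDC) _
    _ = ∫⁻ y, Φ (h y) := by
        rw [lintegral_const_mul' _ _ ENNReal.coe_ne_top,
          lintegral_const_mul' _ _ ENNReal.coe_ne_top, ← mul_assoc, ← mul_assoc,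
          ← ENNReal.coe_mul, ← ENNReal.coe_mul, mul_right_comm, mul_inv_cancel₀ (by positivity),
          ENNReal.coe_one, one_mul]
    _ ≤ 1 := hint

/-! ### Orlicz norms and weak Orlicz norms -/

theorem orliczNorm_le {F : Type*} [ENorm F] {f : E → F} {t : ℝ≥0} (ht : 0 < t)
    (h : ∫⁻ x, Φ (‖f x‖ₑ / t) ≤ 1) : orliczNorm Φ f ≤ t :=
  (iInf_le _ t).trans ((iInf_le _ ht).trans (iInf_le _ h))

/-- A bound in terms of every admissible `t` passes to the infimum; if there is none, the right-hand
side is `c * ∞ = ∞`. -/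
theorem le_mul_orliczNorm {F : Type*} [ENorm F] {f : E → F} {a : ℝ≥0∞} {c : ℝ≥0} (hc : 0 < c)
    (h : ∀ t : ℝ≥0, 0 < t → ∫⁻ x, Φ (‖f x‖ₑ / t) ≤ 1 → a ≤ c * t) :
    a ≤ c * orliczNorm Φ f := by
  have hc0 : (c : ℝ≥0∞) ≠ 0 := by simpa using hc.ne'
  rw [mul_comm, ← ENNReal.div_le_iff hc0 ENNReal.coe_ne_top]
  refine le_iInf fun t => le_iInf fun ht => le_iInf fun ht' => ?_
  rw [ENNReal.div_le_iff hc0 ENNReal.coe_ne_top, mul_comm]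
  exact h t ht ht'

theorem orliczNorm_mono (hΦ : IsYoungFunction Φ) {F G : Type*} [ENorm F] [ENorm G]
    {f : E → F} {g : E → G} (h : ∀ x, ‖f x‖ₑ ≤ ‖g x‖ₑ) : orliczNorm Φ f ≤ orliczNorm Φ g := by
  refine le_iInf fun t => le_iInf fun ht => le_iInf fun ht' => orliczNorm_le ht ?_
  refine (lintegral_mono fun x => hΦ.monotone ?_).trans ht'
  gcongr
  exact h x

theorem lintegral_map_indicator_const (hΦ : IsYoungFunction Φ) {F : Type*} [TopologicalSpace F]
    [ESeminormedAddMonoid F] {B : Set E} (hB : MeasurableSet B) (c : F) (t : ℝ≥0∞) :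
    ∫⁻ x, Φ (‖B.indicator (fun _ => c) x‖ₑ / t) = Φ (‖c‖ₑ / t) * volume B := by
  rw [← lintegral_indicator_const hB]
  refine lintegral_congr fun x => ?_
  by_cases hx : x ∈ B <;> simp [hx, hΦ.map_zero]

theorem MemOrlicz.exists_lintegral_le_one (hΦ : IsYoungFunction Φ) {F : Type*} [TopologicalSpace F]
    [ContinuousENorm F] {f : E → F} (hf : MemOrlicz Φ f) :
    ∃ t : ℝ≥0, 0 < t ∧ ∫⁻ x, Φ (‖f x‖ₑ / t) ≤ 1 := by
  obtain ⟨-, k, hk, hI⟩ := hf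
  obtain ⟨I, hI'⟩ : ∃ I : ℝ≥0, (I : ℝ≥0∞) = ∫⁻ x, Φ (k * ‖f x‖ₑ) :=
    ⟨_, ENNReal.coe_toNNReal hI.ne⟩
  have hpos : 0 < 1 + I := by positivity
  refine ⟨((1 + I)⁻¹ * k)⁻¹, by positivity, ?_⟩
  calc ∫⁻ x, Φ (‖f x‖ₑ / (((1 + I)⁻¹ * k)⁻¹ : ℝ≥0))
      ≤ ∫⁻ x, ((1 + I)⁻¹ : ℝ≥0) * Φ (k * ‖f x‖ₑ) := by
        refine lintegral_mono fun x => ?_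
        refine le_trans (le_of_eq ?_) (hΦ.map_mul_le
          (inv_le_one_of_one_le₀ (le_add_of_nonneg_right zero_le)) _)
        rw [ENNReal.coe_inv (by positivity), div_eq_mul_inv, inv_inv, ENNReal.coe_mul, mul_comm,
          mul_assoc]
    _ = ((1 + I)⁻¹ * I : ℝ≥0) := by
        rw [lintegral_const_mul' _ _ ENNReal.coe_ne_top, ← hI', ENNReal.coe_mul]
    _ ≤ 1 := by
        rw [← ENNReal.coe_one, ENNReal.coe_le_coe, inv_mul_le_iff₀ hpos, mul_one]
        exact le_add_of_nonneg_left zero_le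

theorem orliczNorm_lt_top (hΦ : IsYoungFunction Φ) {F : Type*} [TopologicalSpace F]
    [ContinuousENorm F] {f : E → F} (hf : MemOrlicz Φ f) : orliczNorm Φ f < ∞ := by
  obtain ⟨t, ht, h⟩ := hf.exists_lintegral_le_one hΦ
  exact (orliczNorm_le ht h).trans_lt ENNReal.coe_lt_top

theorem weakOrliczNorm_le_orliczNorm (hΦ : IsYoungFunction Φ) {F : Type*} [ENorm F] (f : E → F) :
    weakOrliczNorm Φ f ≤ orliczNorm Φ f := by
  refine iSup₂_le fun t _ => orliczNorm_mono hΦ fun x => ?_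
  by_cases hx : (t : ℝ≥0∞) < ‖f x‖ₑ
  · simp [hx, hx.le]
  · simp [hx]

/-! ### Sufficiency -/

theorem fracMaximal_div (ρ : ℝ → ℝ) (f : E → 𝕜) {t : ℝ≥0} (ht : 0 < t) (x : E) :
    fracMaximal ρ (fun y => ‖f y‖ₑ / t) x = fracMaximal ρ f x / t := by
  have ht' : (t : ℝ≥0∞)⁻¹ ≠ ∞ := by simpa using ht.ne'
  simp only [ENNReal.div_eq_inv_mul]
  rw [fracMaximal_const_mul ρ ht', fracMaximal_enorm]

theorem RhoCondition.weakBounded (hn : 1 ≤ n) (hΦ : IsYoungFunction Φ) (hΨ : IsYoungFunction Ψ)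
    (hρ : MonotoneOn ρ (Ioi 0)) (hcond : RhoCondition n ρ Φ Ψ) :
    FracMaximalWeakBounded 𝕜 n ρ Φ Ψ := by
  obtain ⟨κ, hκ, H⟩ := exists_map_fracMaximal_le hn hΦ hΨ hρ hcond
  set A : ℝ≥0 := 5 ^ n with hA
  have hA1 : 1 ≤ A := one_le_pow₀ (by norm_num)
  have hA0 : 0 < A := one_pos.trans_le hA1
  refine ⟨A / κ, by positivity, fun f hf => ?_⟩
  have hle : weakOrliczNorm Ψ (fracMaximal ρ f) ≤ (A / κ : ℝ≥0) * orliczNorm Φ f := by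
    refine le_mul_orliczNorm (by positivity) fun t ht hft => ?_
    refine iSup₂_le fun s hs => ?_
    rw [← ENNReal.coe_mul]
    refine orliczNorm_le (by positivity) ?_
    simp only [enorm_eq_self]
    have hmeas : MeasurableSet {x | (s : ℝ≥0∞) < fracMaximal ρ f x} :=
      measurableSet_lt measurable_const (measurable_fracMaximal ρ f)
    have hI := lintegral_map_indicator_const hΨ hmeas (s : ℝ≥0∞) ((A / κ * t : ℝ≥0) : ℝ≥0∞)
    simp only [enorm_eq_self] at hI
    rw [hI]
    -- the superlevel set of `M_ρ f` at `s` lies in that of `M (Φ (|f| / t))` at any level below `y`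
    set y := Ψ ((κ * s / t : ℝ≥0) : ℝ≥0∞) with hy
    have hΨy : Ψ ((s : ℝ≥0∞) / (A / κ * t : ℝ≥0)) ≤ (A⁻¹ : ℝ≥0) * y := by
      refine le_trans (le_of_eq ?_) (hΨ.map_mul_le (inv_le_one_of_one_le₀ hA1) _)
      rw [← ENNReal.coe_div (by positivity), ← ENNReal.coe_mul]
      congr 2
      field_simp
    have hyA : y * volume {x | (s : ℝ≥0∞) < fracMaximal ρ f x} ≤ A := by
      refine ENNReal.mul_le_of_forall_lt fun y' hy' m hm => ?_
      lift y' to ℝ≥0 using hy'.ne_top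
      have hsub : {x | (s : ℝ≥0∞) < fracMaximal ρ f x} ⊆
          {x | (y' : ℝ≥0∞) < fracMaximal (fun _ => 1) (fun z => Φ (‖f z‖ₑ / t)) x} := by
        intro x hx
        refine hy'.trans_le (le_trans ?_ (H (fun z => ‖f z‖ₑ / t) hft x).2)
        rw [fracMaximal_div ρ f ht]
        refine hΨ.monotone ?_
        rw [mul_div_assoc, ENNReal.coe_mul, ENNReal.coe_div ht.ne']
        gcongr
        exact le_of_lt hx
      calc (y' : ℝ≥0∞) * m ≤ y' * volume {x | (y' : ℝ≥0∞) <
            fracMaximal (fun _ => 1) (fun z => Φ (‖f z‖ₑ / t)) x} := by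
            gcongr
            exact hm.le.trans (measure_mono hsub)
        _ ≤ 5 ^ n * ∫⁻ z, Φ (‖f z‖ₑ / t) := mul_volume_lt_fracMaximal_one_le hn _ _
        _ ≤ 5 ^ n * 1 := by gcongr
        _ = A := by simp [hA]
    calc Ψ ((s : ℝ≥0∞) / (A / κ * t : ℝ≥0)) * volume {x | (s : ℝ≥0∞) < fracMaximal ρ f x}
        ≤ (A⁻¹ : ℝ≥0) * y * volume {x | (s : ℝ≥0∞) < fracMaximal ρ f x} := by gcongr
      _ ≤ (A⁻¹ : ℝ≥0) * A := by rw [mul_assoc]; gcongr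
      _ = 1 := by rw [← ENNReal.coe_mul, inv_mul_cancel₀ hA0.ne', ENNReal.coe_one]
  refine ⟨⟨(measurable_fracMaximal ρ f).aestronglyMeasurable, hle.trans_lt ?_⟩, hle⟩
  exact ENNReal.mul_lt_top ENNReal.coe_lt_top (orliczNorm_lt_top hΦ hf)

/-- A finite Orlicz modular forces local integrability, by a linear minorant of the Young
function. -/
theorem locallyIntegrable_of_lintegral_map_lt_top (hΨ : IsYoungFunction Ψ) {g : E → ℝ≥0∞}
    (hg : Measurable g) {k : ℝ≥0} (hk : 0 < k) (h : ∫⁻ x, Ψ (k * g x) < ∞) :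
    LocallyIntegrable g volume := by
  obtain ⟨α, β, hα, hαβ⟩ := hΨ.exists_linear_le
  intro x
  refine ⟨Metric.ball x 1, Metric.ball_mem_nhds x one_pos, hg.aestronglyMeasurable.restrict, ?_⟩
  rw [HasFiniteIntegral]
  simp only [enorm_eq_self]
  have h1 : ((α * k : ℝ≥0) : ℝ≥0∞) * ∫⁻ y in Metric.ball x 1, g y < ∞ :=
    calc ((α * k : ℝ≥0) : ℝ≥0∞) * ∫⁻ y in Metric.ball x 1, g y
        = ∫⁻ y in Metric.ball x 1, α * (k * g y) := by
          rw [← lintegral_const_mul' _ _ ENNReal.coe_ne_top, ENNReal.coe_mul]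
          simp only [mul_assoc]
      _ ≤ ∫⁻ y in Metric.ball x 1, (Ψ (k * g y) + β) := lintegral_mono fun y => hαβ _
      _ = (∫⁻ y in Metric.ball x 1, Ψ (k * g y)) + β * volume (Metric.ball x 1) := by
          rw [lintegral_add_right _ measurable_const, setLIntegral_const]
      _ < ∞ := ENNReal.add_lt_top.2 ⟨(setLIntegral_le_lintegral _ _).trans_lt h,
          ENNReal.mul_lt_top ENNReal.coe_lt_top measure_ball_lt_top⟩
  refine lt_top_iff_ne_top.2 fun htop => ?_
  rw [htop, ENNReal.mul_top (ENNReal.coe_ne_zero.2 (by positivity))] at h1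
  exact lt_irrefl _ h1

theorem RhoCondition.bounded (hn : 1 ≤ n) (hΦ : IsYoungFunction Φ) (hΨ : IsYoungFunction Ψ)
    (hρ : MonotoneOn ρ (Ioi 0)) (hN : Nabla2 Φ) (hcond : RhoCondition n ρ Φ Ψ) :
    FracMaximalBounded 𝕜 n ρ Φ Ψ := by
  obtain ⟨κ, hκ, H⟩ := exists_map_fracMaximal_le hn hΦ hΨ hρ hcond
  obtain ⟨K, hK, HK⟩ := exists_lintegral_map_fracMaximal_one_le hn hΦ hN
  have hK0 : 0 < K := one_pos.trans_le hK
  refine ⟨K / κ, by positivity, fun f hf => ?_⟩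
  have hmod : ∀ t : ℝ≥0, 0 < t → ∫⁻ x, Φ (‖f x‖ₑ / t) ≤ 1 →
      ∫⁻ x, Ψ (fracMaximal ρ f x / (K / κ * t : ℝ≥0)) ≤ 1 := by
    intro t ht hft
    -- the pointwise estimate is applied to `f / (K t)`, since `M (f / t)` has to be divided by `K`
    have hKt : 0 < K * t := by positivity
    have hfKt : ∫⁻ x, Φ (‖f x‖ₑ / (K * t : ℝ≥0)) ≤ 1 := by
      refine (lintegral_mono fun x => hΦ.monotone ?_).trans hft
      gcongr
      exact le_mul_of_one_le_left zero_le hK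
    have hm : AEMeasurable fun y => ‖f y‖ₑ / (t : ℝ≥0∞) :=
      hf.1.aestronglyMeasurable.enorm.div_const _
    refine le_trans (lintegral_mono fun x => ?_) (HK _ hm
      (fun y => ENNReal.div_ne_top enorm_ne_top (by simpa using ht.ne')) hft)
    have hx := (H _ hfKt x).1
    rw [fracMaximal_div ρ f hKt, fracMaximal_div _ f hKt] at hx
    rw [fracMaximal_div _ f ht]
    refine le_trans (le_of_eq ?_) (hx.trans (le_of_eq ?_))
    · congr 1
      have : ((K / κ * t : ℝ≥0) : ℝ≥0∞)⁻¹ = κ * ((K * t : ℝ≥0) : ℝ≥0∞)⁻¹ := by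
        rw [← ENNReal.coe_inv (by positivity), ← ENNReal.coe_inv (by positivity),
          ← ENNReal.coe_mul]
        congr 1
        field_simp
      rw [ENNReal.div_eq_inv_mul, ENNReal.div_eq_inv_mul, this, mul_assoc]
    · congr 1
      rw [div_eq_mul_inv, div_eq_mul_inv, div_eq_mul_inv, ENNReal.coe_mul,
        ENNReal.mul_inv (Or.inr ENNReal.coe_ne_top) (Or.inl ENNReal.coe_ne_top),
        mul_comm (K : ℝ≥0∞)⁻¹, mul_assoc]
  refine ⟨?_, ?_⟩
  · obtain ⟨t, ht, hft⟩ := hf.exists_lintegral_le_one hΦ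
    have hk : 0 < (K / κ * t)⁻¹ := by positivity
    have hfin : ∫⁻ x, Ψ (((K / κ * t)⁻¹ : ℝ≥0) * fracMaximal ρ f x) < ∞ := by
      refine lt_of_le_of_lt (le_of_eq ?_) ((hmod t ht hft).trans_lt ENNReal.one_lt_top)
      refine lintegral_congr fun x => ?_
      rw [ENNReal.coe_inv (by positivity), ENNReal.div_eq_inv_mul]
    exact ⟨locallyIntegrable_of_lintegral_map_lt_top hΨ (measurable_fracMaximal ρ f) hk hfin,
      _, hk, by simpa only [enorm_eq_self] using hfin⟩
  · refine le_mul_orliczNorm (by positivity) fun t ht hft => ?_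
    rw [← ENNReal.coe_mul]
    refine orliczNorm_le (by positivity) ?_
    simpa only [enorm_eq_self] using hmod t ht hft

/-! ### Necessity -/

theorem FracMaximalBounded.weakBounded (hΦ : IsYoungFunction Φ) (hΨ : IsYoungFunction Ψ)
    (h : FracMaximalBounded 𝕜 n ρ Φ Ψ) : FracMaximalWeakBounded 𝕜 n ρ Φ Ψ := by
  obtain ⟨C, hC, H⟩ := h
  refine ⟨C, hC, fun f hf => ?_⟩
  have hle := (weakOrliczNorm_le_orliczNorm hΨ _).trans (H f hf).2
  refine ⟨⟨(H f hf).1.1.aestronglyMeasurable, hle.trans_lt ?_⟩, hle⟩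
  exact ENNReal.mul_lt_top ENNReal.coe_lt_top (orliczNorm_lt_top hΦ hf)

/-- On `B(0, R)` the maximal function of the indicator of `B(0, R)` is bounded below by comparison
with the ball of radius `2 R`. -/
theorem le_fracMaximal_indicator_ball (hρ : MonotoneOn ρ (Ioi 0)) {R : ℝ} (hR : 0 < R) {x : E}
    (hx : x ∈ Metric.ball (0 : E) R) :
    ENNReal.ofReal (ρ R) / 2 ^ n ≤
      fracMaximal ρ ((Metric.ball (0 : E) R).indicator fun _ => (1 : 𝕜)) x := by
  have h2R : 0 < 2 * R := by positivity
  have hsub : Metric.ball (0 : E) R ⊆ Metric.ball x (2 * R) := by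
    refine Metric.ball_subset_ball' ?_
    rw [Metric.mem_ball, dist_comm] at hx
    linarith
  have hB0 := volume_ball_ne_zero (0 : E) hR
  have hB1 := volume_ball_ne_top (0 : E) (r := R)
  have hvol : volume (Metric.ball x (2 * R)) = 2 ^ n * volume (Metric.ball (0 : E) R) := by
    rw [volume_ball_eq x h2R, volume_ball_eq 0 hR, mul_pow, ENNReal.ofReal_mul (by positivity),
      ENNReal.ofReal_pow (by norm_num), ENNReal.ofReal_ofNat, mul_assoc]
  have hint : volume (Metric.ball (0 : E) R) ≤ ∫⁻ y in Metric.ball x (2 * R),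
      ‖(Metric.ball (0 : E) R).indicator (fun _ => (1 : 𝕜)) y‖ₑ := by
    simp only [enorm_indicator_eq_indicator_enorm, enorm_one]
    rw [setLIntegral_indicator Metric.isOpen_ball.measurableSet, inter_eq_self_of_subset_left hsub]
    simp
  calc ENNReal.ofReal (ρ R) / 2 ^ n
      = ENNReal.ofReal (ρ R) / volume (Metric.ball x (2 * R)) *
          volume (Metric.ball (0 : E) R) := by
        rw [hvol, div_eq_mul_inv, div_eq_mul_inv, ENNReal.mul_inv (Or.inr hB1)
          (Or.inl (by simp)), mul_assoc, mul_assoc, ENNReal.inv_mul_cancel hB0 hB1, mul_one]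
    _ ≤ ENNReal.ofReal (ρ (2 * R)) / volume (Metric.ball x (2 * R)) *
          ∫⁻ y in Metric.ball x (2 * R),
            ‖(Metric.ball (0 : E) R).indicator (fun _ => (1 : 𝕜)) y‖ₑ := by
        gcongr
        exact hρ hR h2R (by linarith)
    _ ≤ _ := le_iSup₂ (f := fun (r : ℝ) (_ : 0 < r) =>
        ENNReal.ofReal (ρ r) / volume (Metric.ball x r) * ∫⁻ y in Metric.ball x r,
          ‖(Metric.ball (0 : E) R).indicator (fun _ => (1 : 𝕜)) y‖ₑ) (2 * R) h2R

theorem FracMaximalWeakBounded.rhoCondition (hn : 1 ≤ n) (hΦ : IsYoungFunction Φ)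
    (hΨ : IsYoungFunction Ψ) (hρ_pos : ∀ r : ℝ, 0 < r → 0 < ρ r)
    (hρ_mono : MonotoneOn ρ (Ioi 0))
    (hρ_anti : AntitoneOn (fun r : ℝ => r ^ (-(n : ℤ)) * ρ r) (Ioi 0))
    (h : FracMaximalWeakBounded 𝕜 n ρ Φ Ψ) : RhoCondition n ρ Φ Ψ := by
  obtain ⟨C, hC, H⟩ := h
  have hv1 := volume_ball_ne_top (0 : E) (r := 1)
  set v : ℝ≥0 := (volume (Metric.ball (0 : E) 1)).toNNReal with hv
  have hv' : (v : ℝ≥0∞) = volume (Metric.ball (0 : E) 1) := ENNReal.coe_toNNReal hv1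
  have hv0 : 0 < v := by
    rw [← ENNReal.coe_pos, hv']
    exact pos_iff_ne_zero.2 (volume_ball_ne_zero 0 one_pos)
  set w : ℝ := ((v : ℝ)⁻¹) ^ ((n : ℝ)⁻¹) with hw
  have hvinv : (0 : ℝ) < (v : ℝ)⁻¹ := by positivity
  have hw0 : 0 < w := Real.rpow_pos_of_pos hvinv _
  have hwn : w ^ n = (v : ℝ)⁻¹ := Real.rpow_inv_natCast_pow hvinv.le (by omega)
  refine ⟨max 1 v * (2 ^ n * C), by positivity, fun r hr => ?_⟩
  -- the test function is the indicator of the ball of volume `r ^ n`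
  set R : ℝ := r * w with hRdef
  have hR : 0 < R := by positivity
  set B := Metric.ball (0 : E) R with hB
  have hBm : MeasurableSet B := Metric.isOpen_ball.measurableSet
  have hB0 : volume B ≠ 0 := volume_ball_ne_zero 0 hR
  have hB1 : volume B ≠ ∞ := volume_ball_ne_top 0
  set s := ENNReal.ofReal (r ^ (-(n : ℤ))) with hs
  have hvolB : volume B = s⁻¹ := by
    rw [hB, volume_ball_eq 0 hR, ← hv', hs, zpow_neg, zpow_natCast,
      ENNReal.ofReal_inv_of_pos (pow_pos hr n), inv_inv, hRdef, mul_pow, hwn,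
      ENNReal.ofReal_mul (by positivity), ENNReal.ofReal_inv_of_pos (by positivity),
      ENNReal.ofReal_coe_nnreal, mul_assoc,
      ENNReal.inv_mul_cancel (by simpa using hv0.ne') ENNReal.coe_ne_top, mul_one]
  have hs0 : s ≠ 0 := (ENNReal.ofReal_pos.2 (zpow_pos hr _)).ne'
  have hs1 : s ≠ ∞ := ENNReal.ofReal_ne_top
  obtain ⟨p, hp⟩ : ∃ p : ℝ≥0, (p : ℝ≥0∞) = youngInv Φ s :=
    ⟨_, ENNReal.coe_toNNReal (hΦ.youngInv_ne_top hs1)⟩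
  have hp0 : 0 < p := by
    rw [← ENNReal.coe_pos, hp]
    exact pos_iff_ne_zero.2 (hΦ.youngInv_ne_zero hs0)
  have hq0 := hΨ.youngInv_ne_zero hs0
  have hq1 := hΨ.youngInv_ne_top hs1
  set f : E → 𝕜 := B.indicator fun _ => (1 : 𝕜) with hf
  have hfp : ∫⁻ x, Φ (‖f x‖ₑ / (p⁻¹ : ℝ≥0)) ≤ 1 := by
    rw [hf, lintegral_map_indicator_const hΦ hBm, enorm_one, ENNReal.coe_inv hp0.ne', one_div,
      inv_inv, hvolB, hp]
    calc Φ (youngInv Φ s) * s⁻¹ ≤ s * s⁻¹ := by gcongr; exact hΦ.map_youngInv_le s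
      _ = 1 := ENNReal.mul_inv_cancel hs0 hs1
  have hfmem : MemOrlicz Φ f := by
    refine ⟨((integrable_indicator_iff hBm).2 (integrableOn_const hB1)).locallyIntegrable,
      p, hp0, lt_of_le_of_lt (le_of_eq ?_) (hfp.trans_lt ENNReal.one_lt_top)⟩
    refine lintegral_congr fun x => ?_
    rw [ENNReal.coe_inv hp0.ne', div_eq_mul_inv, inv_inv, mul_comm]
  have hweak : weakOrliczNorm Ψ (fracMaximal ρ f) ≤ C * (p⁻¹ : ℝ≥0) := by
    refine (H f hfmem).2.trans ?_
    gcongr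
    exact orliczNorm_le (by positivity) hfp
  have hlevel : ENNReal.ofReal (ρ R) / 2 ^ n ≤ C * (youngInv Ψ s / youngInv Φ s) := by
    refine le_of_forall_lt_imp_le_of_dense fun l hl => ?_
    lift l to ℝ≥0 using hl.ne_top
    rcases eq_or_ne l 0 with rfl | hl0
    · simp
    have hsub : B ⊆ {x | (l : ℝ≥0∞) < fracMaximal ρ f x} := fun x hx =>
      hl.trans_le (le_fracMaximal_indicator_ball hρ_mono hR hx)
    have hmeas : MeasurableSet {x | (l : ℝ≥0∞) < fracMaximal ρ f x} :=
      measurableSet_lt measurable_const (measurable_fracMaximal ρ f)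
    have hlow : (l : ℝ≥0∞) / youngInv Ψ s ≤ orliczNorm Ψ
        ({x | (l : ℝ≥0∞) < fracMaximal ρ f x}.indicator fun _ => (l : ℝ≥0∞)) := by
      refine le_iInf fun t => le_iInf fun ht => le_iInf fun ht' => ?_
      rw [lintegral_map_indicator_const hΨ hmeas, enorm_eq_self] at ht'
      have h1 : Ψ ((l : ℝ≥0∞) / t) * s⁻¹ ≤ 1 := by
        rw [← hvolB]
        exact le_trans (by gcongr) ht'
      have h2 : Ψ ((l : ℝ≥0∞) / t) ≤ s := by
        rw [← div_eq_mul_inv] at h1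
        simpa using (ENNReal.div_le_iff hs0 hs1).1 h1
      have h3 := hΨ.le_youngInv h2
      rw [ENNReal.div_le_iff (by simpa using ht.ne') ENNReal.coe_ne_top] at h3
      exact (ENNReal.div_le_iff hq0 hq1).2 (by rwa [mul_comm])
    have hsup : orliczNorm Ψ
        ({x | (l : ℝ≥0∞) < fracMaximal ρ f x}.indicator fun _ => (l : ℝ≥0∞)) ≤
        weakOrliczNorm Ψ (fracMaximal ρ f) :=
      le_iSup₂ (f := fun (t : ℝ≥0) (_ : 0 < t) => orliczNorm Ψ
        ({x | (t : ℝ≥0∞) < ‖fracMaximal ρ f x‖ₑ}.indicator fun _ => (t : ℝ≥0∞))) l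
        (pos_iff_ne_zero.2 hl0)
    have h4 := (ENNReal.div_le_iff hq0 hq1).1 (hlow.trans (hsup.trans hweak))
    rw [ENNReal.coe_inv hp0.ne', hp] at h4
    refine h4.trans (le_of_eq ?_)
    rw [div_eq_mul_inv, mul_assoc, mul_comm (youngInv Φ s)⁻¹]
  have hρR : ρ r ≤ max 1 (v : ℝ) * ρ R := by
    have hρR0 := hρ_pos R hR
    rcases le_total r R with hrR | hrR
    · calc ρ r ≤ 1 * ρ R := by rw [one_mul]; exact hρ_mono hr hR hrR
        _ ≤ _ := by gcongr; exact le_max_left _ _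
    · have h5 : r ^ (-(n : ℤ)) * ρ r ≤ R ^ (-(n : ℤ)) * ρ R := hρ_anti hR hr hrR
      rw [zpow_neg, zpow_neg, zpow_natCast, zpow_natCast, hRdef, mul_pow, hwn, mul_inv, inv_inv,
        mul_assoc, ← hRdef] at h5
      calc ρ r ≤ v * ρ R := le_of_mul_le_mul_left h5 (by positivity)
        _ ≤ _ := by gcongr; exact le_max_right _ _
  calc ENNReal.ofReal (ρ r) ≤ ENNReal.ofReal (max 1 (v : ℝ) * ρ R) := ENNReal.ofReal_le_ofReal hρR
    _ = (max 1 v : ℝ≥0) * ENNReal.ofReal (ρ R) := by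
        rw [ENNReal.ofReal_mul (by positivity), ← NNReal.coe_one, ← NNReal.coe_max,
          ENNReal.ofReal_coe_nnreal]
    _ ≤ (max 1 v : ℝ≥0) * ((2 : ℝ≥0∞) ^ n * (C * (youngInv Ψ s / youngInv Φ s))) := by
        gcongr
        have h2 : (2 : ℝ≥0∞) ^ n ≠ 0 := by simp
        rw [mul_comm]
        exact (ENNReal.div_le_iff h2 (by simp)).1 hlevel
    _ = _ := by
        push_cast
        ring

end Maximal

theorem mainTheorem2 (𝕜 : Type*) [RCLike 𝕜] (n : ℕ) (hn : 1 ≤ n)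
    (Φ Ψ : ℝ≥0∞ → ℝ≥0∞) (hΦ : IsYoungFunction Φ) (hΨ : IsYoungFunction Ψ)
    (ρ : ℝ → ℝ) (hρ_pos : ∀ r : ℝ, 0 < r → 0 < ρ r)
    (hρ_mono : MonotoneOn ρ (Ioi 0))
    (hρ_anti : AntitoneOn (fun r : ℝ => r ^ (-(n : ℤ)) * ρ r) (Ioi 0)) :
    (RhoCondition n ρ Φ Ψ ↔ FracMaximalWeakBounded 𝕜 n ρ Φ Ψ) ∧
      (Nabla2 Φ → (RhoCondition n ρ Φ Ψ ↔ FracMaximalBounded 𝕜 n ρ Φ Ψ)) := by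
  have hnec : FracMaximalWeakBounded 𝕜 n ρ Φ Ψ → RhoCondition n ρ Φ Ψ :=
    FracMaximalWeakBounded.rhoCondition hn hΦ hΨ hρ_pos hρ_mono hρ_anti
  exact ⟨⟨RhoCondition.weakBounded hn hΦ hΨ hρ_mono, hnec⟩, fun hN =>
    ⟨RhoCondition.bounded hn hΦ hΨ hρ_mono hN, fun h => hnec (h.weakBounded hΦ hΨ)⟩⟩
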